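/- Let $\mathbb{K}$ be an algebraically closed field of characteristic zero. A rational map $\mathbb{P}^{m}(\mathbb{K})\dashrightarrow\mathbb{P}^{n}(\mathbb{K})$ is given by a tuple $\mathcal{M}=(m_1:\cdots:m_{n+1})$ of homogeneous polynomials of the same degree, not all zero; two tuples give the same rational map if they are proportional. Its generic fiber is $$\mathscr{F}_g(\mathcal{M})=\{\overline{\alpha}\in\mathbb{P}^{m}(\overline{\mathbb{K}(\overline{h})})\mid \mathcal{M}(\overline{\alpha})=\mathcal{M}(\overline{h})\},$$ where $\overline{h}=(h_1,\ldots,h_{m+1})$ are independent variables and $\overline{\mathbb{K}(\overline{h})}$ is the algebraic closure of $\mathbb{K}(\overline{h})$. Let $\mathscr{S}\subset\mathbb{P}^{3}(\mathbb{K})$ be an irreducible projective surface and let $\mathcal{P}=(p_1:p_2:p_3:p_4):\mathbb{P}^{2}(\mathbb{K})\dashrightarrow\mathbb{P}^{3}(\mathbb{K})$ be a rational parametrization of $\mathscr{S}$ (the Zariski closure of the image of $\mathcal{P}$ is $\mathscr{S}$) with $p_4\neq 0$. Let $\mathcal{Q}:\mathbb{P}^{2}(\mathbb{K})\dashrightarrow\mathbb{P}^{3}(\mathbb{K})$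 and $\mathcal{S}=(s_1:s_2:s_3):\mathbb{P}^{2}(\mathbb{K})\dashrightarrow\mathbb{P}^{2}(\mathbb{K})$ be rational maps with $s_3\neq 0$ and $\mathcal{Q}\circ\mathcal{S}=\mathcal{P}$. The following statements are equivalent: 1. $(\mathcal{Q},\mathcal{S})$ solves the birational reparametrization problem for $\mathcal{P}$, that is, $\mathcal{Q}$ is a birational parametrization of $\mathscr{S}$ (it parametrizes $\mathscr{S}$ and has a rational inverse $\mathscr{S}\dashrightarrow\mathbb{P}^{2}(\mathbb{K})$) and $\mathcal{P}=\mathcal{Q}\circ\mathcal{S}$. 2. $\mathscr{F}_g(\mathcal{P})=\mathscr{F}_g(\mathcal{S})$. Furthermore, if either of these two equivalent conditions holds, then: (a) For each $j\in\{1,2,3\}$, $$\Phi_j(t_1,t_2)=\left(\frac{s_1(t_1,t_2,1)}{s_3(t_1,t_2,1)},\frac{s_2(t_1,t_2,1)}{s_3(t_1,t_2,1)},\frac{p_j(t_1,t_2,1)}{p_4(t_1,t_2,1)}\right)$$ parametrizes an affine surface in $\mathbb{A}^3(\mathbb{K})$ (the Zariski closure of its image) that is defined by an irreducible polynomial of the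 form $A_{j,1}(x,y)-A_{j,0}(x,y)\,z$ with $A_{j,0}\neq 0$. (b) For any such polynomials, $\mathcal{Q}$ is the homogenization, with $t_3$ as homogenization variable, of $$\mathcal{T}=\left(\frac{A_{1,1}(t_1,t_2)}{A_{1,0}(t_1,t_2)},\frac{A_{2,1}(t_1,t_2)}{A_{2,0}(t_1,t_2)},\frac{A_{3,1}(t_1,t_2)}{A_{3,0}(t_1,t_2)}\right),$$ that is, $\mathcal{Q}(t_1,t_2,t_3)=\left(\mathcal{T}\left(\tfrac{t_1}{t_3},\tfrac{t_2}{t_3}\right):1\right)$ as rational maps. -/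

import Mathlib

open MvPolynomial
open scoped LinearAlgebra.Projectivization

noncomputable section

namespace BirRep

/-- The field `K(t₁, …, t_m)` of rational functions in `m` variables. -/
abbrev RatFun (K : Type*) [Field K] (m : ℕ) : Type _ :=
  FractionRing (MvPolynomial (Fin m) K)

/-- A representative `(m₁ : ⋯ : m_{n+1})` of a rational map `ℙᵐ(K) ⇢ ℙⁿ(K)`: homogeneous
polynomials of one common degree, not all zero. A common factor is allowed. -/
structure RatMap (K : Type*) [Field K] (m n : ℕ) where
  coord : Fin (n + 1) → MvPolynomial (Fin (m + 1)) K
  deg : ℕ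
  homogeneous : ∀ i, (coord i).IsHomogeneous deg
  exists_ne_zero : ∃ i, coord i ≠ 0

namespace RatMap

variable {K : Type*} [Field K] {m n k : ℕ}

/-- The partial map that `M` induces on the points of projective space over an extension `L` of
`K`. It is defined where the coordinates of `M` do not all vanish; by homogeneity the choice of
homogeneous coordinates of the argument is immaterial. -/
def toPFun (M : RatMap K m n) (L : Type*) [Field L] [Algebra K L] :
    ℙ L (Fin (m + 1) → L) →. ℙ L (Fin (n + 1) → L) := fun x =>
  { Dom := (fun i => aeval x.rep (M.coord i)) ≠ 0
    get := fun h => Projectivization.mk L (fun i => aeval x.rep (M.coord i)) h }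

/-- The identity map of `ℙᵐ(K)`. -/
def id (K : Type*) [Field K] (m : ℕ) : RatMap K m m where
  coord := X
  deg := 1
  homogeneous := fun i => isHomogeneous_X K i
  exists_ne_zero := ⟨0, X_ne_zero 0⟩

/-- The coordinates of the composition `Q ∘ S`, obtained by substitution. -/
def compCoord (Q : RatMap K n k) (S : RatMap K m n) :
    Fin (k + 1) → MvPolynomial (Fin (m + 1)) K :=
  fun i => bind₁ S.coord (Q.coord i)

/-- `Q ∘ S = P` as rational maps: the composition makes sense (its coordinates are not all zero)
and its tuple of coordinates is proportional to that of `P`. -/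
def IsComp (Q : RatMap K n k) (S : RatMap K m n) (P : RatMap K m k) : Prop :=
  (∃ i, compCoord Q S i ≠ 0) ∧
    ∀ i j, compCoord Q S i * P.coord j = compCoord Q S j * P.coord i

/-- The affine rational map `M_a = (m₁/m_{n+1}, …, m_n/m_{n+1})(t₁, …, t_m, 1)`; it is meaningful
if the last coordinate of `M` is not zero. -/
def affine (M : RatMap K m n) : Fin n → RatFun K m := fun i =>
  algebraMap (MvPolynomial (Fin m) K) (RatFun K m)
      (aeval (Fin.snoc X 1 : Fin (m + 1) → MvPolynomial (Fin m) K) (M.coord i.castSucc)) /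
    algebraMap (MvPolynomial (Fin m) K) (RatFun K m)
      (aeval (Fin.snoc X 1 : Fin (m + 1) → MvPolynomial (Fin m) K) (M.coord (Fin.last n)))

end RatMap

section Generic

variable (K : Type*) [Field K] (m : ℕ)

/-- The algebraic closure of `K(h₁, …, h_{m+1})`. -/
abbrev GenField : Type _ := AlgebraicClosure (RatFun K (m + 1))

/-- The point `(t₁ : ⋯ : t_{m+1})` of projective space over an extension field `L` of
`K(t₁, …, t_{m+1})`. -/
def genPoint (L : Type*) [Field L] [Algebra (RatFun K (m + 1)) L] : ℙ L (Fin (m + 1) → L) :=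
  Projectivization.mk L
    (fun i => algebraMap (RatFun K (m + 1)) L
      (algebraMap (MvPolynomial (Fin (m + 1)) K) (RatFun K (m + 1)) (X i)))
    (by
      intro h
      have h0 := congrFun h 0
      simp only [Pi.zero_apply, map_eq_zero] at h0
      exact X_ne_zero (R := K) (0 : Fin (m + 1))
        ((IsFractionRing.injective (MvPolynomial (Fin (m + 1)) K) (RatFun K (m + 1)))
          (h0.trans (map_zero _).symm)))

end Generic

/-- The generic fiber of `M`: the points `α` of `ℙᵐ` over the algebraic closure of `K(h)` such that
`M(α) = M(h)`, both sides being defined. -/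
def genericFiber {K : Type*} [Field K] {m n : ℕ} (M : RatMap K m n) :
    Set (ℙ (GenField K m) (Fin (m + 1) → GenField K m)) :=
  {α | ∃ y, y ∈ M.toPFun (GenField K m) α ∧ y ∈ M.toPFun (GenField K m) (genPoint K m _)}

section Projective

variable {K : Type*} [Field K] {m n : ℕ}

/-- Zariski closure in projective space: the common zeros of all the homogeneous polynomials that
vanish on `A`. -/
def projClosure (A : Set (ℙ K (Fin n → K))) : Set (ℙ K (Fin n → K)) :=
  {x | ∀ (F : MvPolynomial (Fin n) K) (d : ℕ), F.IsHomogeneous d →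
    (∀ y ∈ A, eval y.rep F = 0) → eval x.rep F = 0}

/-- An (irreducible) projective surface in `ℙ³(K)`. -/
def IsProjSurface (V : Set (ℙ K (Fin 4 → K))) : Prop :=
  ∃ (F : MvPolynomial (Fin 4) K) (d : ℕ), Irreducible F ∧ F.IsHomogeneous d ∧
    V = {x | eval x.rep F = 0}

/-- `M` parametrizes `V`: the image of `M` is Zariski dense in `V`, and `V` is closed. -/
def Parametrizes (M : RatMap K m n) (V : Set (ℙ K (Fin (n + 1) → K))) : Prop :=
  projClosure (M.toPFun K).ran = V

/-- `Q` is a birational parametrization of `V`: it parametrizes `V` and has a rational inverse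
`R : V ⇢ ℙᵐ(K)`, given by forms in the homogeneous coordinates of the ambient space, with
`R ∘ Q = id` on `ℙᵐ(K)` and `Q ∘ R = id` on `V`. -/
def IsBirationalParametrization (Q : RatMap K m n) (V : Set (ℙ K (Fin (n + 1) → K))) : Prop :=
  Parametrizes Q V ∧ ∃ R : RatMap K n m,
    RatMap.IsComp R Q (RatMap.id K m) ∧
    (∃ x ∈ V, ∃ i, eval x.rep (RatMap.compCoord Q R i) ≠ 0) ∧
    ∀ x ∈ V, ∀ i j, eval x.rep (RatMap.compCoord Q R i * X j) =
      eval x.rep (RatMap.compCoord Q R j * X i)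

/-- `(Q, S)` solves the birational reparametrization problem for the parametrization `P` of `V`. -/
def SolvesReparam (V : Set (ℙ K (Fin 4 → K))) (P : RatMap K 2 3) (Q : RatMap K 2 3)
    (S : RatMap K 2 2) : Prop :=
  IsBirationalParametrization Q V ∧ RatMap.IsComp Q S P

end Projective

section Affine

variable {K : Type*} [Field K] {m n : ℕ}

/-- The rational function `φ` is regular at the `L`-point `a` and has the value `y` there. -/
def HasValueAt (φ : RatFun K m) {L : Type*} [Field L] [Algebra K L] (a : Fin m → L) (y : L) :
    Prop :=
  ∃ f g : MvPolynomial (Fin m) K, aeval a g ≠ 0 ∧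
    φ = algebraMap _ (RatFun K m) f / algebraMap _ (RatFun K m) g ∧
    y = aeval a f / aeval a g

/-- The image of the affine rational map `φ : 𝔸ᵐ(K) ⇢ 𝔸ⁿ(K)`. -/
def affImage (φ : Fin n → RatFun K m) : Set (Fin n → K) :=
  {y | ∃ a : Fin m → K, ∀ i, HasValueAt (φ i) a (y i)}

/-- `φ` parametrizes the affine hypersurface `H = 0`: the Zariski closure of its image is the zero
set of `H`. -/
def ParametrizesAffine (φ : Fin n → RatFun K m) (H : MvPolynomial (Fin n) K) : Prop :=
  zeroLocus K (vanishingIdeal K (affImage φ)) = zeroLocus K (Ideal.span {H})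

/-- The map `(y₁, …, y_n) ↦ (y₁ : ⋯ : y_n : 1)`. -/
def toProj {L : Type*} [Field L] (y : Fin n → L) : ℙ L (Fin (n + 1) → L) :=
  Projectivization.mk L (Fin.snoc y 1 : Fin (n + 1) → L) (by
    intro h
    have := congrFun h (Fin.last n)
    simp at this)

/-- `Q` is the homogenization of the affine rational map `T = (T₁, …, T_n)`, the last variable
being the homogenization variable: with `τ = (t₁/t_{m+1}, …, t_m/t_{m+1})`, one has
`Q(t) = (T₁(τ) : ⋯ : T_n(τ) : 1)` over the field `K(t₁, …, t_{m+1})`. -/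
def IsHomogenization (Q : RatMap K m n) (T : Fin n → RatFun K m) : Prop :=
  ∃ y : Fin n → RatFun K (m + 1),
    (∀ j, HasValueAt (T j)
      (fun i : Fin m =>
        algebraMap (MvPolynomial (Fin (m + 1)) K) (RatFun K (m + 1)) (X i.castSucc) /
          algebraMap (MvPolynomial (Fin (m + 1)) K) (RatFun K (m + 1)) (X (Fin.last m)))
      (y j)) ∧
    toProj y ∈ Q.toPFun (RatFun K (m + 1)) (genPoint K m (RatFun K (m + 1)))

/-- `Φ_j = (s₁/s₃, s₂/s₃, p_j/p₄)(t₁, t₂, 1)`. -/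
def Phi (P : RatMap K 2 3) (S : RatMap K 2 2) (j : Fin 3) : Fin 3 → RatFun K 2 :=
  ![S.affine 0, S.affine 1, P.affine j]

/-- The polynomial `A₁(x, y) - A₀(x, y) z`. -/
def linearInZ (A₁ A₀ : MvPolynomial (Fin 2) K) : MvPolynomial (Fin 3) K :=
  rename Fin.castSucc A₁ - rename Fin.castSucc A₀ * X (Fin.last 2)

/-- `A₁ - A₀ z`, with `A₀ ≠ 0`, is an irreducible polynomial that defines the affine surface
parametrized by `φ`. -/
def IsImplicitEq (φ : Fin 3 → RatFun K 2) (A₁ A₀ : MvPolynomial (Fin 2) K) : Prop :=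
  A₀ ≠ 0 ∧ Irreducible (linearInZ A₁ A₀) ∧ ParametrizesAffine φ (linearInZ A₁ A₀)

end Affine

end BirRep

end

/-! Everything rests on the dominance of `S`: `algebraicIndependent_inner` shows that its three
coordinates are algebraically independent, because three coordinates of `Q ∘ S` are. Substituting
`S` into polynomials is therefore injective, and identities for `Q` may be tested after composing
with `S`. Hence `Q` is birational exactly when `R ∘ P = S` for some rational map `R`
(`isBirationalParametrization_iff`).

If such an `R` exists, each of `P` and `S` factors through the other, and composing can only enlarge
a generic fiber (`genericFiber_inner_subset`), so the fibers agree. Conversely, let `E = K(p₁(h), …,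
p₄(h))`. The algebraic closure of `K(h)` is Galois over `E`, and every automorphism `σ` over `E`
sends `h` to a point of the generic fiber of `P`, hence of `S`. So `σ` fixes the ratios of the
`sᵢ(h)`, and these lie in `E` (`div_mem_adjoin_of_genericFiber_subset`). Taking homogeneous
components and clearing denominators turns this into forms defining `R`.

For (a) and (b), composition gives `p_j/p₄ = (q_j/q₄)(s₁/s₃, s₂/s₃)` in affine coordinates. Writing
`q_j/q₄` in lowest terms yields the equation linear in `z`. Any other such equation gives the same
fraction, since `s₁/s₃` and `s₂/s₃` are algebraically independent. -/

noncomputable section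

namespace BirRep

/-! ### Forms: scaling, homogeneous components, substitution. -/

section Homogeneous

variable {σ ι R A : Type*} [CommRing R] [CommRing A] [Algebra R A]

/-- A form of degree `d` scales by `c ^ d` when its argument is scaled by `c`. -/
theorem aeval_mul_of_isHomogeneous {F : MvPolynomial σ R} {d : ℕ} (hF : F.IsHomogeneous d)
    (c : A) (v : σ → A) : aeval (fun i => c * v i) F = c ^ d * aeval v F := by
  simp only [aeval_def, eval₂_eq, Finset.mul_sum]
  refine Finset.sum_congr rfl fun s hs => ?_
  rw [hF.degree_eq_sum_deg_support hs]
  simp only [mul_pow, Finset.prod_mul_distrib, Finset.prod_pow_eq_pow_sum]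
  ring

/-- The values of a form at two proportional points are proportional. -/
theorem pow_mul_aeval_of_proportional {F : MvPolynomial σ R} {d : ℕ} (hF : F.IsHomogeneous d)
    {u v : σ → A} (h : ∀ i j, u i * v j = u j * v i) (l : σ) :
    v l ^ d * aeval u F = u l ^ d * aeval v F := by
  rw [← aeval_mul_of_isHomogeneous hF, ← aeval_mul_of_isHomogeneous hF]
  congr 2
  funext i
  rw [mul_comm, h i l]

theorem homogeneousComponent_add_mul (f s : MvPolynomial σ R) {D : ℕ} (hs : s.IsHomogeneous D)
    (n : ℕ) : homogeneousComponent (n + D) (f * s) = homogeneousComponent n f * s := by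
  conv_lhs => rw [← sum_homogeneousComponent f, Finset.sum_mul, map_sum]
  have hk : ∀ k, homogeneousComponent (n + D) (homogeneousComponent k f * s) =
      if k = n then homogeneousComponent k f * s else 0 := fun k => by
    rw [homogeneousComponent_of_mem ((homogeneousComponent_isHomogeneous k f).mul hs)]
    simp [eq_comm]
  simp only [hk, Finset.sum_ite_eq', Finset.mem_range]
  split_ifs with h
  · rfl
  · rw [homogeneousComponent_eq_zero _ _ (by omega), zero_mul]

/-- Substituting forms of degree `d` multiplies degrees by `d`; positivity of `d` keeps distinct
degrees distinct. -/
theorem homogeneousComponent_aeval {p : ι → MvPolynomial σ R} {d : ℕ} (hd : 0 < d)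
    (hp : ∀ i, (p i).IsHomogeneous d) (H : MvPolynomial ι R) (e : ℕ) :
    homogeneousComponent (d * e) (aeval p H) = aeval p (homogeneousComponent e H) := by
  conv_lhs => rw [← sum_homogeneousComponent H, map_sum, map_sum]
  have hk : ∀ k, homogeneousComponent (d * e) (aeval p (homogeneousComponent k H)) =
      if k = e then aeval p (homogeneousComponent k H) else 0 := fun k => by
    rw [homogeneousComponent_of_mem ((homogeneousComponent_isHomogeneous k H).aeval p hp)]
    simp [hd.ne', eq_comm]
  simp only [hk, Finset.sum_ite_eq', Finset.mem_range]
  split_ifs with h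
  · rfl
  · rw [homogeneousComponent_eq_zero _ _ (by omega), map_zero]

/-- Forms of one positive degree that satisfy no homogeneous relation are algebraically
independent. -/
theorem algebraicIndependent_of_isHomogeneous {p : ι → MvPolynomial σ R} {d : ℕ} (hd : 0 < d)
    (hp : ∀ i, (p i).IsHomogeneous d)
    (h : ∀ (H : MvPolynomial ι R) (e : ℕ), H.IsHomogeneous e → aeval p H = 0 → H = 0) :
    AlgebraicIndependent R p := by
  rw [algebraicIndependent_iff]
  intro H hH
  rw [← sum_homogeneousComponent H]
  refine Finset.sum_eq_zero fun e _ => h _ e (homogeneousComponent_isHomogeneous e H) ?_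
  rw [← homogeneousComponent_aeval hd hp, hH, map_zero]

end Homogeneous

/-! ### Algebraic independence by counting transcendence degree. -/

section Independence

variable {K : Type*} [Field K]

/-- Three forms of one degree that satisfy no homogeneous relation have positive degree. -/
theorem degree_pos_of_no_relation {σ : Type*} {p : Fin 3 → MvPolynomial σ K} {d : ℕ}
    (hp : ∀ i, (p i).IsHomogeneous d)
    (h : ∀ (H : MvPolynomial (Fin 3) K) (e : ℕ), H.IsHomogeneous e → aeval p H = 0 → H = 0) :
    0 < d := by
  rcases Nat.eq_zero_or_pos d with rfl | hd
  · have hc : ∀ i, p i = C (coeff 0 (p i)) := fun i =>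
      (totalDegree_eq_zero_iff_eq_C).1 ((totalDegree_zero_iff_isHomogeneous _).2 (hp i))
    have h1 : p 1 ≠ 0 := fun h1 => X_ne_zero (R := K) (1 : Fin 3)
      (h (X 1) 1 (isHomogeneous_X _ _) (by rw [aeval_X, h1]))
    -- Two constants `c₀, c₁` always satisfy `c₁X₀ - c₀X₁`; if this relation is trivial, then `c₁ =
    -- 0`.
    have h2 := h (C (coeff 0 (p 1)) * X 0 - C (coeff 0 (p 0)) * X 1) 1
      ((isHomogeneous_C_mul_X _ _).sub (isHomogeneous_C_mul_X _ _)) (by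
        simp only [map_sub, map_mul, aeval_X, aeval_C, algebraMap_eq, ← hc]
        ring)
    have h3 := congrArg (coeff (Finsupp.single 0 1)) h2
    simp [coeff_C_mul, coeff_X, Finsupp.single_left_inj] at h3
    exact absurd (by rw [hc 1, h3, C_0]) h1
  · exact hd

/-- If a field generated by a finite family contains an algebraically independent family of the
same size, then the generating family is algebraically independent. -/
theorem AlgebraicIndependent.of_mem_adjoin {L ι : Type*} [Field L] [Algebra K L] [Finite ι]
    {x y : ι → L} (hy : AlgebraicIndependent K y)
    (h : ∀ i, y i ∈ IntermediateField.adjoin K (Set.range x)) : AlgebraicIndependent K x := by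
  set E := IntermediateField.adjoin K (Set.range x)
  let x' : ι → E := fun i => ⟨x i, IntermediateField.subset_adjoin K _ ⟨i, rfl⟩⟩
  let y' : ι → E := fun i => ⟨y i, h i⟩
  have hy' : AlgebraicIndependent K y' := AlgebraicIndependent.of_comp E.val hy
  have hx' : ∀ r, (E.val (aeval x' r)) = aeval x r := fun r => by
    rw [← AlgHom.comp_apply, comp_aeval]
    rfl
  have : Algebra.IsAlgebraic (Algebra.adjoin K (Set.range x')) E := ⟨fun z => by
    obtain ⟨r, s, hrs⟩ := (IntermediateField.mem_adjoin_range_iff K x (z : L)).1 z.2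
    have hz : z = aeval x' r / aeval x' s := by
      apply E.val.injective
      exact hrs.trans (by rw [← hx', ← hx']; exact (map_div₀ E.val _ _).symm)
    have hmem : ∀ t : MvPolynomial ι K, IsAlgebraic (Algebra.adjoin K (Set.range x')) (aeval (R := K) x' t) := fun t => by
      have : aeval (R := K) x' t ∈ Algebra.adjoin K (Set.range x') := by
        rw [Algebra.adjoin_range_eq_range_aeval]
        exact ⟨t, rfl⟩
      exact isAlgebraic_algebraMap (⟨_, this⟩ : Algebra.adjoin K (Set.range x'))
    rw [hz, div_eq_mul_inv]
    exact (hmem r).mul (hmem s).inv⟩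
  -- `y'` bounds the transcendence degree of `E` from below by the size of `ι`, and `E` is algebraic
  -- over `K[x']`, so `x'` has no room for a relation.
  have hb := Algebra.IsAlgebraic.isTranscendenceBasis_of_lift_le_trdeg_of_finite K x'
    hy'.lift_cardinalMk_le_trdeg
  exact hb.1.map' (f := E.val) E.val.injective

theorem AlgebraicIndependent.of_eq_aeval {L ι : Type*} [Field L] [Algebra K L] [Finite ι]
    {x y : ι → L} (hy : AlgebraicIndependent K y) (F : ι → MvPolynomial ι K)
    (h : ∀ i, y i = aeval x (F i)) : AlgebraicIndependent K x :=
  AlgebraicIndependent.of_mem_adjoin hy fun i => by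
    rw [h i]
    exact IntermediateField.algebra_adjoin_le_adjoin K _
      (by rw [Algebra.adjoin_range_eq_range_aeval]; exact ⟨F i, rfl⟩)

/-- Evaluation at an algebraically independent point does not kill a nonzero polynomial. -/
theorem aeval_ne_zero {L ι : Type*} [CommRing L] [Algebra K L] {x : ι → L}
    (hx : AlgebraicIndependent K x) {F : MvPolynomial ι K} (hF : F ≠ 0) : aeval x F ≠ 0 :=
  fun h => hF (hx.eq_zero_of_aeval_eq_zero F h)

end Independence

/-! ### Projective points, values of rational maps, closure of the image. -/

section Points

variable {K : Type*} [Field K] {L : Type*} [Field L] [Algebra K L] {m n : ℕ}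

theorem exists_mk_rep_eq {σ : Type*} (v : σ → L) (hv : v ≠ 0) :
    ∃ c : L, c ≠ 0 ∧ (Projectivization.mk L v hv).rep = fun i => c * v i := by
  obtain ⟨a, ha⟩ := Projectivization.exists_smul_eq_mk_rep L v hv
  exact ⟨a, a.ne_zero, ha.symm⟩

theorem mk_eq_mk_iff_exists {σ : Type*} {v w : σ → L} (hv : v ≠ 0) (hw : w ≠ 0) :
    Projectivization.mk L v hv = Projectivization.mk L w hw ↔
      ∃ c : L, c ≠ 0 ∧ ∀ i, v i = c * w i := by
  rw [Projectivization.mk_eq_mk_iff]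
  constructor
  · rintro ⟨a, ha⟩
    exact ⟨a, a.ne_zero, fun i => (congrFun ha i).symm⟩
  · rintro ⟨c, hc, h⟩
    exact ⟨Units.mk0 c hc, funext fun i => (h i).symm⟩

theorem eval_rep_mk_eq_zero_iff {σ : Type*} {F : MvPolynomial σ K} {d : ℕ}
    (hF : F.IsHomogeneous d) (v : σ → K) (hv : v ≠ 0) :
    eval (Projectivization.mk K v hv).rep F = 0 ↔ eval v F = 0 := by
  obtain ⟨c, hc, h⟩ := exists_mk_rep_eq v hv
  have : eval (fun i => c * v i) F = c ^ d * eval v F := aeval_mul_of_isHomogeneous hF c v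
  rw [h, this]
  simp [hc]

theorem mem_toPFun_mk_iff (M : RatMap K m n) (v : Fin (m + 1) → L) (hv : v ≠ 0)
    (y : ℙ L (Fin (n + 1) → L)) :
    y ∈ M.toPFun L (Projectivization.mk L v hv) ↔
      ∃ h : (fun i => aeval v (M.coord i)) ≠ 0,
        Projectivization.mk L (fun i => aeval v (M.coord i)) h = y := by
  obtain ⟨c, hc, h⟩ := exists_mk_rep_eq v hv
  have hM : ∀ i, aeval (Projectivization.mk L v hv).rep (M.coord i) =
      c ^ M.deg * aeval v (M.coord i) := fun i => by
    rw [h, aeval_mul_of_isHomogeneous (M.homogeneous i)]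
  have hne : (fun i => aeval (Projectivization.mk L v hv).rep (M.coord i)) ≠ 0 ↔
      (fun i => aeval v (M.coord i)) ≠ 0 := by
    rw [not_iff_not]
    simp [funext_iff, hM, hc]
  have hmk : ∀ h1 h2, Projectivization.mk L
      (fun i => aeval (Projectivization.mk L v hv).rep (M.coord i)) h1 =
      Projectivization.mk L (fun i => aeval v (M.coord i)) h2 := fun h1 h2 =>
    (mk_eq_mk_iff_exists h1 h2).2 ⟨c ^ M.deg, pow_ne_zero _ hc, hM⟩
  constructor
  · rintro ⟨h1, h2⟩
    exact ⟨hne.1 h1, (hmk h1 _).symm.trans h2⟩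
  · rintro ⟨h1, h2⟩
    exact ⟨hne.2 h1, (hmk (hne.2 h1) h1).trans h2⟩

/-- A form vanishes on the image of a rational map if and only if substituting the coordinates of
the map into it gives zero. -/
theorem vanishes_on_ran_iff [Infinite K] (M : RatMap K m n) {H : MvPolynomial (Fin (n + 1)) K}
    {e : ℕ} (hH : H.IsHomogeneous e) :
    (∀ y ∈ (M.toPFun K).ran, eval y.rep H = 0) ↔ aeval M.coord H = 0 := by
  have hev : ∀ v, eval v (aeval M.coord H) = eval (fun i => aeval v (M.coord i)) H := fun v => by
    rw [← coe_aeval_eq_eval, ← coe_aeval_eq_eval]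
    exact DFunLike.congr_fun (comp_aeval M.coord (aeval v)) H
  constructor
  · intro h
    obtain ⟨i, hi⟩ := M.exists_ne_zero
    -- The extra factor restricts attention to vectors that are nonzero and at which `M` is defined.
    have h0 : aeval M.coord H * (M.coord i * X 0) = 0 := by
      apply MvPolynomial.funext
      intro v
      by_contra hne
      simp only [map_mul, map_zero, eval_X, mul_eq_zero, not_or] at hne
      obtain ⟨h1, h2, h3⟩ := hne
      have hv : v ≠ 0 := fun hv => h3 (by rw [hv]; rfl)
      have hM : (fun i => aeval v (M.coord i)) ≠ 0 := fun hM => h2 (congrFun hM i)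
      apply h1
      rw [hev, ← eval_rep_mk_eq_zero_iff hH _ hM]
      exact h _ ⟨_, (mem_toPFun_mk_iff M v hv _).2 ⟨hM, rfl⟩⟩
    exact (mul_eq_zero.1 h0).resolve_right (mul_ne_zero hi (X_ne_zero _))
  · rintro h y ⟨x, hx⟩
    rw [← Projectivization.mk_rep x] at hx
    obtain ⟨h1, rfl⟩ := (mem_toPFun_mk_iff M _ _ _).1 hx
    rw [eval_rep_mk_eq_zero_iff hH, ← hev, h, map_zero]

theorem vanishes_on_iff [Infinite K] {M : RatMap K m n} {V : Set (ℙ K (Fin (n + 1) → K))}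
    (hM : Parametrizes M V) {H : MvPolynomial (Fin (n + 1)) K} {e : ℕ} (hH : H.IsHomogeneous e) :
    (∀ x ∈ V, eval x.rep H = 0) ↔ aeval M.coord H = 0 := by
  rw [← vanishes_on_ran_iff M hH, ← hM]
  exact ⟨fun h y hy => h y fun F d _ hF' => hF' y hy, fun h x hx => hx H e hH h⟩

/-- Two rational maps whose coordinates satisfy the same homogeneous relations have the same
closure of the image. -/
theorem Parametrizes.of_relations_iff [Infinite K] {m' : ℕ} {M : RatMap K m n} {N : RatMap K m' n}
    {V : Set (ℙ K (Fin (n + 1) → K))} (hM : Parametrizes M V)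
    (h : ∀ (H : MvPolynomial (Fin (n + 1)) K) (e : ℕ), H.IsHomogeneous e →
      (aeval N.coord H = 0 ↔ aeval M.coord H = 0)) : Parametrizes N V := by
  rw [Parametrizes, ← hM]
  ext x
  refine forall₃_congr fun F d hF => ?_
  rw [vanishes_on_ran_iff N hF, vanishes_on_ran_iff M hF, h F d hF]

end Points

/-! ### Homogeneous relations on a surface, via the Nullstellensatz. -/

section Surface

variable {K : Type*} [Field K] [IsAlgClosed K]

theorem dvd_of_vanishes {σ : Type*} [Finite σ] {F H : MvPolynomial σ K} (hF : Irreducible F)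
    (h : ∀ x, eval x F = 0 → eval x H = 0) : F ∣ H := by
  have hp : Prime F := hF.prime
  have : (Ideal.span {F}).IsPrime := (Ideal.span_singleton_prime hp.ne_zero).2 hp
  rw [← Ideal.mem_span_singleton, ← IsPrime.vanishingIdeal_zeroLocus (k := K) (K := K) (Ideal.span {F})]
  intro x hx
  exact h x (hx F (Ideal.mem_span_singleton_self F))

theorem dvd_of_mem_relations {P : RatMap K 2 3} {V : Set (ℙ K (Fin 4 → K))}
    (hP : Parametrizes P V) {F : MvPolynomial (Fin 4) K} {d : ℕ} (hF : Irreducible F)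
    (hFd : F.IsHomogeneous d) (hV : V = {x | eval x.rep F = 0}) {H : MvPolynomial (Fin 4) K}
    {e : ℕ} (hH : H.IsHomogeneous e) (h : aeval P.coord H = 0) : F ∣ H := by
  have : Infinite K := IsAlgClosed.instInfinite
  -- The Nullstellensatz is applied to the affine cone, which contains the origin; there `H`
  -- vanishes only if its degree is positive, so constants are treated apart.
  rcases Nat.eq_zero_or_pos e with rfl | he
  · have hc := totalDegree_eq_zero_iff_eq_C.1 ((totalDegree_zero_iff_isHomogeneous _).2 hH)
    rw [hc, aeval_C, algebraMap_eq, C_eq_zero] at h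
    rw [hc, h, C_0]
    exact dvd_zero F
  · refine dvd_of_vanishes hF fun x hx => ?_
    by_cases hx0 : x = 0
    · subst hx0
      have := aeval_mul_of_isHomogeneous hH (0 : K) (0 : Fin 4 → K)
      simpa [he.ne', coe_aeval_eq_eval, ← Pi.zero_def] using this
    · rw [← eval_rep_mk_eq_zero_iff hH x hx0]
      refine (vanishes_on_iff hP hH).2 h _ ?_
      rw [hV, Set.mem_ofPred_eq, eval_rep_mk_eq_zero_iff hFd]
      exact hx

/-- Some three of the coordinates of a parametrization of a surface satisfy no homogeneous
relation. -/
theorem exists_no_relation {P : RatMap K 2 3} {V : Set (ℙ K (Fin 4 → K))}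
    (hV : IsProjSurface V) (hP : Parametrizes P V) : ∃ i : Fin 4,
      ∀ (H : MvPolynomial (Fin 3) K) (e : ℕ), H.IsHomogeneous e →
        aeval (fun k => P.coord (i.succAbove k)) H = 0 → H = 0 := by
  obtain ⟨F, d, hF, hFd, hVF⟩ := hV
  -- The coordinate to drop is one that occurs in `F`: a relation among the other three is a
  -- multiple of `F` of degree `0` in `X i`, hence zero.
  obtain ⟨i, hi⟩ : F.vars.Nonempty := by
    rw [Finset.nonempty_iff_ne_empty]
    intro h
    have hc := (vars_eq_empty_iff_eq_C (p := F)).1 h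
    have h0 : coeff 0 F ≠ 0 := fun h0 => hF.ne_zero (by rw [hc, h0, C_0])
    exact hF.not_isUnit (by rw [hc]; exact (isUnit_iff_ne_zero.2 h0).map C)
  refine ⟨i, fun H e hH h => ?_⟩
  have hdvd : F ∣ rename i.succAbove H :=
    dvd_of_mem_relations hP hF hFd hVF hH.rename_isHomogeneous (by rw [aeval_rename]; exact h)
  by_contra hne
  obtain ⟨G, hG⟩ := hdvd
  have hr : rename i.succAbove H ≠ 0 := fun h0 =>
    hne (rename_injective _ Fin.succAbove_right_injective (h0.trans (map_zero _).symm))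
  have hG0 : G ≠ 0 := fun h0 => hr (by rw [hG, h0, mul_zero])
  have hdeg := degreeOf_mul_eq (n := i) hF.ne_zero hG0
  rw [← hG] at hdeg
  have hpos := mem_vars_iff_degreeOf_ne_zero.1 hi
  have : i ∈ (rename i.succAbove H).vars := mem_vars_iff_degreeOf_ne_zero.2 (by omega)
  obtain ⟨k, -, hk⟩ := mem_vars_rename _ _ this
  exact Fin.succAbove_ne i k hk

end Surface

/-! ### Composition of rational maps. -/

section Composition

variable {K : Type*} [Field K] {m n k : ℕ}

theorem compCoord_isHomogeneous (Q : RatMap K n k) (S : RatMap K m n) (i : Fin (k + 1)) :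
    (RatMap.compCoord Q S i).IsHomogeneous (S.deg * Q.deg) :=
  (Q.homogeneous i).aeval S.coord S.homogeneous

theorem compCoord_ne_zero {Q : RatMap K n k} {S : RatMap K m n} {P : RatMap K m k}
    (h : RatMap.IsComp Q S P) {l : Fin (k + 1)} (hl : P.coord l ≠ 0) :
    RatMap.compCoord Q S l ≠ 0 := fun h0 => by
  obtain ⟨⟨i, hi⟩, hprop⟩ := h
  have := hprop l i
  rw [h0, zero_mul, eq_comm, mul_eq_zero] at this
  exact this.elim hi hl

/-- Proportional tuples give a form values that differ by nonzero factors, so `Q ∘ S` may replace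
`P` in any homogeneous relation. -/
theorem relation_compCoord_iff {Q : RatMap K n k} {S : RatMap K m n} {P : RatMap K m k}
    (h : RatMap.IsComp Q S P) {H : MvPolynomial (Fin (k + 1)) K} {e : ℕ}
    (hH : H.IsHomogeneous e) :
    aeval (RatMap.compCoord Q S) H = 0 ↔ aeval P.coord H = 0 := by
  obtain ⟨l, hl⟩ := P.exists_ne_zero
  have := pow_mul_aeval_of_proportional hH h.2 l
  have h1 := pow_ne_zero e hl
  have h2 := pow_ne_zero e (compCoord_ne_zero h hl)
  constructor
  · intro h0
    rw [h0, mul_zero, eq_comm] at this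
    exact (mul_eq_zero.1 this).resolve_left h2
  · intro h0
    rw [h0, mul_zero] at this
    exact (mul_eq_zero.1 this).resolve_left h1

theorem aeval_compCoord {A : Type*} [CommRing A] [Algebra K A] (Q : RatMap K n k) (S : RatMap K m n)
    (v : Fin (m + 1) → A) (i : Fin (k + 1)) :
    aeval v (RatMap.compCoord Q S i) = aeval (fun j => aeval v (S.coord j)) (Q.coord i) :=
  DFunLike.congr_fun (comp_aeval S.coord (aeval v)) (Q.coord i)

theorem algebraicIndependent_algebraMap {σ ι L : Type*} [Field L] [Algebra (MvPolynomial σ K) L]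
    [Algebra K L] [IsScalarTower K (MvPolynomial σ K) L] [FaithfulSMul (MvPolynomial σ K) L]
    {x : ι → MvPolynomial σ K} :
    AlgebraicIndependent K (fun i => algebraMap (MvPolynomial σ K) L (x i)) ↔
      AlgebraicIndependent K x :=
  ⟨fun h => AlgebraicIndependent.of_comp (IsScalarTower.toAlgHom K (MvPolynomial σ K) L) h,
    fun h => h.map' (f := IsScalarTower.toAlgHom K (MvPolynomial σ K) L)
      (FaithfulSMul.algebraMap_injective _ _)⟩

theorem deg_pos_of_algebraicIndependent (M : RatMap K m n) {f : Fin 3 → Fin (n + 1)}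
    (h : AlgebraicIndependent K fun i => M.coord (f i)) : 0 < M.deg :=
  degree_pos_of_no_relation (fun i => M.homogeneous (f i))
    fun H _ _ hH => h.eq_zero_of_aeval_eq_zero H hH

end Composition

/-! ### Dominance of the inner map. -/

section Dominance

variable {K : Type*} [Field K] [IsAlgClosed K] {V : Set (ℙ K (Fin 4 → K))} {P Q : RatMap K 2 3}
  {S : RatMap K 2 2}

theorem exists_algebraicIndependent_coord (hV : IsProjSurface V) (hP : Parametrizes P V) :
    ∃ f : Fin 3 → Fin 4, AlgebraicIndependent K fun i => P.coord (f i) := by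
  obtain ⟨i, hi⟩ := exists_no_relation hV hP
  exact ⟨i.succAbove, algebraicIndependent_of_isHomogeneous
    (degree_pos_of_no_relation (fun k => P.homogeneous _) hi) (fun k => P.homogeneous _) hi⟩

/-- The inner map of a decomposition of a parametrization of a surface is dominant. -/
theorem algebraicIndependent_inner (hV : IsProjSurface V) (hP : Parametrizes P V)
    (hQS : RatMap.IsComp Q S P) : AlgebraicIndependent K S.coord := by
  obtain ⟨i, hi⟩ := exists_no_relation hV hP
  have hrel : ∀ (H : MvPolynomial (Fin 3) K) (e : ℕ), H.IsHomogeneous e →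
      aeval (fun k => RatMap.compCoord Q S (i.succAbove k)) H = 0 → H = 0 := fun H e hH h0 => by
    refine hi H e hH ?_
    have := (relation_compCoord_iff hQS (hH.rename_isHomogeneous (f := i.succAbove))).1
      (by rw [aeval_rename]; exact h0)
    rwa [aeval_rename] at this
  have hind := algebraicIndependent_of_isHomogeneous
    (degree_pos_of_no_relation (fun k => compCoord_isHomogeneous Q S _) hrel)
    (fun k => compCoord_isHomogeneous Q S _) hrel
  -- The transcendence degree count takes place in a field, hence the passage to fractions.
  rw [← algebraicIndependent_algebraMap (L := RatFun K 3)] at hind ⊢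
  refine AlgebraicIndependent.of_eq_aeval hind (fun k => Q.coord (i.succAbove k)) fun k => ?_
  exact (DFunLike.congr_fun (comp_aeval S.coord
    (IsScalarTower.toAlgHom K (MvPolynomial (Fin 3) K) (RatFun K 3))) _)

end Dominance

/-! ### Generic fibers in homogeneous coordinates. -/

section GenericFiber

variable {K : Type*} [Field K] {m n : ℕ}

variable (K m) in
/-- The generic vector `h = (h₁, …, h_{m+1})`. -/
def genVec : Fin (m + 1) → GenField K m := fun i =>
  algebraMap (RatFun K (m + 1)) _ (algebraMap (MvPolynomial (Fin (m + 1)) K) _ (X i))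

theorem aeval_genVec (F : MvPolynomial (Fin (m + 1)) K) :
    aeval (genVec K m) F = algebraMap (MvPolynomial (Fin (m + 1)) K) (GenField K m) F := by
  have : (aeval (genVec K m) : MvPolynomial (Fin (m + 1)) K →ₐ[K] GenField K m) =
      IsScalarTower.toAlgHom K (MvPolynomial (Fin (m + 1)) K) (GenField K m) := by
    ext i
    simp [genVec, ← IsScalarTower.algebraMap_apply]
  exact DFunLike.congr_fun this F

instance : FaithfulSMul (MvPolynomial (Fin (m + 1)) K) (GenField K m) :=
  FaithfulSMul.trans (MvPolynomial (Fin (m + 1)) K) (RatFun K (m + 1)) (GenField K m)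

theorem isTranscendenceBasis_genVec : IsTranscendenceBasis K (genVec K m) := by
  have h := IsTranscendenceBasis.mvPolynomial (Fin (m + 1)) K
  have : Algebra.IsAlgebraic (MvPolynomial (Fin (m + 1)) K) (RatFun K (m + 1)) :=
    IsLocalization.isAlgebraic _ (nonZeroDivisors (MvPolynomial (Fin (m + 1)) K))
  have : Algebra.IsAlgebraic (MvPolynomial (Fin (m + 1)) K) (GenField K m) :=
    Algebra.IsAlgebraic.trans (MvPolynomial (Fin (m + 1)) K) (RatFun K (m + 1)) (GenField K m)
  exact h.algebraMap_comp (A := GenField K m)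

theorem genVec_ne_zero : genVec K m ≠ 0 := fun h =>
  (isTranscendenceBasis_genVec (K := K) (m := m)).1.ne_zero 0 (congrFun h 0)

theorem algebraicIndependent_aeval_genVec {ι : Type*} {x : ι → MvPolynomial (Fin (m + 1)) K}
    (h : AlgebraicIndependent K x) :
    AlgebraicIndependent K fun i => aeval (genVec K m) (x i) := by
  simp only [aeval_genVec]
  exact algebraicIndependent_algebraMap.2 h

/-- Definedness needs no separate condition: `M(h) ≠ 0` because `h` is algebraically independent,
and `c ≠ 0` carries this over to `v`. -/
theorem mk_mem_genericFiber_iff (M : RatMap K m n) (v : Fin (m + 1) → GenField K m) (hv : v ≠ 0) :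
    Projectivization.mk (GenField K m) v hv ∈ genericFiber M ↔
      ∃ c : GenField K m, c ≠ 0 ∧
        ∀ i, aeval v (M.coord i) = c * aeval (genVec K m) (M.coord i) := by
  have hgen : (fun i => aeval (genVec K m) (M.coord i)) ≠ 0 := fun h => by
    obtain ⟨i, hi⟩ := M.exists_ne_zero
    exact aeval_ne_zero isTranscendenceBasis_genVec.1 hi (congrFun h i)
  have hpt : genPoint K m (GenField K m) =
    Projectivization.mk (GenField K m) (genVec K m) genVec_ne_zero := rfl
  constructor
  · rintro ⟨y, h1, h2⟩
    rw [hpt] at h2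
    obtain ⟨h3, rfl⟩ := (mem_toPFun_mk_iff M _ _ _).1 h1
    obtain ⟨h4, h5⟩ := (mem_toPFun_mk_iff M _ _ _).1 h2
    exact (mk_eq_mk_iff_exists h3 h4).1 h5.symm
  · rintro ⟨c, hc, h⟩
    have hne : (fun i => aeval v (M.coord i)) ≠ 0 := fun h0 => hgen <| funext fun i => by
      have := (h i).symm.trans (congrFun h0 i)
      exact (mul_eq_zero.1 this).resolve_left hc
    refine ⟨Projectivization.mk _ _ hgen, (mem_toPFun_mk_iff M _ _ _).2 ⟨hne, ?_⟩, ?_⟩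
    · exact (mk_eq_mk_iff_exists hne hgen).2 ⟨c, hc, h⟩
    · rw [hpt]
      exact (mem_toPFun_mk_iff M _ _ _).2 ⟨hgen, rfl⟩

/-- A point of the generic fiber of a generically finite map has algebraically independent
homogeneous coordinates at which the map takes exactly the value it takes at the generic vector. -/
theorem exists_generic_coordinates (M : RatMap K m n) (hdeg : 0 < M.deg)
    {f : Fin (m + 1) → Fin (n + 1)} (hM : AlgebraicIndependent K fun i => M.coord (f i))
    {α : ℙ (GenField K m) (Fin (m + 1) → GenField K m)} (hα : α ∈ genericFiber M) :
    ∃ (β : Fin (m + 1) → GenField K m) (hβ : β ≠ 0), α = Projectivization.mk _ β hβ ∧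
      AlgebraicIndependent K β ∧
      ∀ i, aeval β (M.coord i) = aeval (genVec K m) (M.coord i) := by
  induction α using Projectivization.ind with
  | h v hv =>
    obtain ⟨c, hc, h⟩ := (mk_mem_genericFiber_iff M v hv).1 hα
    -- Dividing `v` by a root `z` of `z ^ M.deg = c` normalizes the proportionality constant to `1`.
    obtain ⟨z, hz⟩ := IsAlgClosed.exists_pow_nat_eq c hdeg
    have hz0 : z ≠ 0 := fun h0 => hc (by rw [← hz, h0, zero_pow hdeg.ne'])
    have hval : ∀ i, aeval (fun j => z⁻¹ * v j) (M.coord i) =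
        aeval (genVec K m) (M.coord i) := fun i => by
      rw [aeval_mul_of_isHomogeneous (M.homogeneous i), h i, inv_pow, hz, inv_mul_cancel_left₀ hc]
    have hne : (fun j => z⁻¹ * v j) ≠ 0 := fun h0 => hv <| funext fun j =>
      (mul_eq_zero.1 (congrFun h0 j)).resolve_left (inv_ne_zero hz0)
    refine ⟨_, hne, (mk_eq_mk_iff_exists hv hne).2 ⟨z, hz0, fun i => ?_⟩, ?_, hval⟩
    · rw [mul_inv_cancel_left₀ hz0]
    · exact AlgebraicIndependent.of_eq_aeval (algebraicIndependent_aeval_genVec hM)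
        (fun i => M.coord (f i)) fun i => (hval (f i)).symm

/-- If the values of `M` at a vector are proportional to fixed data `r`, as are those at the
generic vector, then the vector represents a point of the generic fiber. -/
theorem mk_mem_genericFiber_of_proportional (M : RatMap K m n) {β : Fin (m + 1) → GenField K m}
    (hβ : β ≠ 0) (hind : AlgebraicIndependent K β) (r : Fin (n + 1) → GenField K m)
    {l : Fin (n + 1)} (hrl : r l ≠ 0) (hMl : M.coord l ≠ 0)
    (h1 : ∀ i, r l * aeval β (M.coord i) = r i * aeval β (M.coord l))
    (h2 : ∀ i, r l * aeval (genVec K m) (M.coord i) = r i * aeval (genVec K m) (M.coord l)) :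
    Projectivization.mk (GenField K m) β hβ ∈ genericFiber M := by
  have h3 := aeval_ne_zero hind hMl
  have h4 := aeval_ne_zero (isTranscendenceBasis_genVec (K := K) (m := m)).1 hMl
  refine (mk_mem_genericFiber_iff M β hβ).2
    ⟨aeval β (M.coord l) / aeval (genVec K m) (M.coord l), div_ne_zero h3 h4, fun i => ?_⟩
  apply mul_left_cancel₀ hrl
  rw [h1, mul_left_comm, h2]
  field_simp

/-- The generic fiber of the inner map is contained in that of the composition. -/
theorem genericFiber_inner_subset {k : ℕ} {P : RatMap K m k} {Q : RatMap K n k} {S : RatMap K m n}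
    (hdeg : 0 < S.deg) {f : Fin (m + 1) → Fin (n + 1)}
    (hS : AlgebraicIndependent K fun i => S.coord (f i)) (hQS : RatMap.IsComp Q S P) :
    genericFiber S ⊆ genericFiber P := by
  intro α hα
  obtain ⟨β, hβ, rfl, hind, hval⟩ := exists_generic_coordinates S hdeg hS hα
  obtain ⟨l, hl⟩ := P.exists_ne_zero
  refine mk_mem_genericFiber_of_proportional P hβ hind
    (fun i => aeval (genVec K m) (RatMap.compCoord Q S i)) (l := l)
    (aeval_ne_zero isTranscendenceBasis_genVec.1 (compCoord_ne_zero hQS hl)) hl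
    (fun i => ?_) fun i => ?_
  -- `S` takes equal values at `β` and at `h`, hence so does `Q ∘ S`; proportionality to `P` may be
  -- used at either vector.
  · have hc : ∀ i, aeval (genVec K m) (RatMap.compCoord Q S i) =
        aeval β (RatMap.compCoord Q S i) := fun i => by
      rw [aeval_compCoord, aeval_compCoord]
      simp only [hval]
    simp only [hc, ← map_mul, hQS.2 l i]
  · simp only [← map_mul, hQS.2 l i]

end GenericFiber

/-! ### Birationality of `Q` as a factorization of `S` through `P`. -/

section Inverse

variable {K : Type*} [Field K] {m n k : ℕ} {P : RatMap K m k} {Q : RatMap K n k} {S : RatMap K m n}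

/-- For `P = Q ∘ S` with `S` dominant, `R` is a left inverse of `Q` if and only if
`R ∘ P = S`. -/
theorem isComp_id_iff (hS : AlgebraicIndependent K S.coord) (hQS : RatMap.IsComp Q S P)
    (R : RatMap K k n) : RatMap.IsComp R Q (RatMap.id K n) ↔ RatMap.IsComp R P S := by
  obtain ⟨l, hl⟩ := P.exists_ne_zero
  have hl' := compCoord_ne_zero hQS hl
  have hcomp : ∀ i, aeval S.coord (RatMap.compCoord R Q i) =
      aeval (RatMap.compCoord Q S) (R.coord i) := fun i => aeval_compCoord R Q S.coord i
  have hpow : ∀ i, P.coord l ^ R.deg * aeval (RatMap.compCoord Q S) (R.coord i) =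
      RatMap.compCoord Q S l ^ R.deg * RatMap.compCoord R P i := fun i =>
    pow_mul_aeval_of_proportional (R.homogeneous i) hQS.2 l
  have hinj : ∀ F : MvPolynomial (Fin (n + 1)) K, aeval S.coord F = 0 ↔ F = 0 := fun F =>
    ⟨hS.eq_zero_of_aeval_eq_zero F, fun h => by rw [h, map_zero]⟩
  have h1 : ∀ i, RatMap.compCoord R Q i ≠ 0 ↔ RatMap.compCoord R P i ≠ 0 := fun i => by
    rw [not_iff_not, ← hinj, hcomp]
    exact relation_compCoord_iff hQS (R.homogeneous i)
  -- Substituting `S` loses nothing, and `hpow` trades `R ∘ (Q ∘ S)` for `R ∘ P` at the cost of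
  -- nonzero factors.
  have h2 : ∀ i j, RatMap.compCoord R Q i * X j = RatMap.compCoord R Q j * X i ↔
      RatMap.compCoord R P i * S.coord j = RatMap.compCoord R P j * S.coord i := fun i j => by
    rw [← sub_eq_zero, ← hinj, map_sub, map_mul, map_mul, aeval_X, aeval_X, hcomp, hcomp,
      ← mul_right_inj' (pow_ne_zero R.deg hl), mul_sub, ← mul_assoc, ← mul_assoc, hpow, hpow,
      mul_assoc, mul_assoc, ← mul_sub, mul_zero, mul_eq_zero,
      or_iff_right (pow_ne_zero R.deg hl'), sub_eq_zero]
  exact and_congr (exists_congr h1) (forall₂_congr h2)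

/-- If `P = Q ∘ S` and `R ∘ P = S`, then `Q ∘ R` is the identity on the closure of the image
of `P`. -/
theorem comp_eq_id_on [Infinite K] {V : Set (ℙ K (Fin (k + 1) → K))} (hP : Parametrizes P V)
    (hQS : RatMap.IsComp Q S P) {R : RatMap K k n} (hR : RatMap.IsComp R P S) :
    (∃ x ∈ V, ∃ i, eval x.rep (RatMap.compCoord Q R i) ≠ 0) ∧
    ∀ x ∈ V, ∀ i j, eval x.rep (RatMap.compCoord Q R i * X j) =
      eval x.rep (RatMap.compCoord Q R j * X i) := by
  obtain ⟨l, hl⟩ := S.exists_ne_zero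
  have hl' := compCoord_ne_zero hR hl
  -- A form vanishes on `V` if and only if it vanishes after substituting `P`, and `(Q ∘ R) ∘ P` is
  -- `Q ∘ S` up to nonzero factors.
  have hpow : ∀ i, S.coord l ^ Q.deg * aeval P.coord (RatMap.compCoord Q R i) =
      RatMap.compCoord R P l ^ Q.deg * RatMap.compCoord Q S i := fun i => by
    rw [aeval_compCoord]
    exact pow_mul_aeval_of_proportional (Q.homogeneous i) hR.2 l
  constructor
  · by_contra! hall
    obtain ⟨i, hi⟩ := hQS.1
    have h0 := (vanishes_on_iff hP (compCoord_isHomogeneous Q R i)).1 fun x hx => hall x hx i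
    have := hpow i
    rw [h0, mul_zero, eq_comm, mul_eq_zero] at this
    exact this.elim (pow_ne_zero _ hl') hi
  · intro x hx i j
    rw [← sub_eq_zero, ← map_sub]
    refine (vanishes_on_iff hP (((compCoord_isHomogeneous Q R i).mul (isHomogeneous_X K j)).sub
      ((compCoord_isHomogeneous Q R j).mul (isHomogeneous_X K i)))).2 ?_ x hx
    rw [map_sub, map_mul, map_mul, aeval_X, aeval_X, ← mul_right_inj' (pow_ne_zero Q.deg hl),
      mul_sub, ← mul_assoc, ← mul_assoc, hpow, hpow, mul_assoc, mul_assoc, hQS.2 i j, sub_self,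
      mul_zero]

theorem parametrizes_outer [Infinite K] {V : Set (ℙ K (Fin (k + 1) → K))} (hP : Parametrizes P V)
    (hS : AlgebraicIndependent K S.coord) (hQS : RatMap.IsComp Q S P) : Parametrizes Q V := by
  refine Parametrizes.of_relations_iff hP fun H e hH => ?_
  rw [← relation_compCoord_iff hQS hH]
  have : aeval (RatMap.compCoord Q S) H = aeval S.coord (aeval Q.coord H) :=
    (DFunLike.congr_fun (comp_aeval Q.coord (aeval S.coord)) H).symm
  rw [this]
  exact ⟨fun h => by rw [h, map_zero], hS.eq_zero_of_aeval_eq_zero _⟩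

/-- For `P = Q ∘ S` with `S` dominant, `Q` is birational if and only if `S` factors rationally
through `P`. -/
theorem isBirationalParametrization_iff [Infinite K] {V : Set (ℙ K (Fin (k + 1) → K))}
    (hP : Parametrizes P V) (hS : AlgebraicIndependent K S.coord) (hQS : RatMap.IsComp Q S P) :
    IsBirationalParametrization Q V ↔ ∃ R : RatMap K k n, RatMap.IsComp R P S := by
  constructor
  · rintro ⟨-, R, hR, -⟩
    exact ⟨R, (isComp_id_iff hS hQS R).1 hR⟩
  · rintro ⟨R, hR⟩
    exact ⟨parametrizes_outer hP hS hQS, R, (isComp_id_iff hS hQS R).2 hR,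
      comp_eq_id_on hP hQS hR⟩

end Inverse

/-! ### Galois descent from generic fibers to a factorization. -/

section Galois

variable {K : Type*} [Field K] [CharZero K] {m n k : ℕ}

/-- If the generic fiber of `P` is contained in that of `S`, then the ratios of the coordinates of
`S` at the generic vector lie in the field generated by the coordinates of `P`. -/
theorem div_mem_adjoin_of_genericFiber_subset {P : RatMap K m k} {S : RatMap K m n}
    {f : Fin (m + 1) → Fin (k + 1)} (hP : AlgebraicIndependent K fun i => P.coord (f i))
    (h : genericFiber P ⊆ genericFiber S) (i l : Fin (n + 1)) :
    aeval (genVec K m) (S.coord i) / aeval (genVec K m) (S.coord l) ∈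
      IntermediateField.adjoin K (Set.range fun i => aeval (genVec K m) (P.coord i)) := by
  set E := IntermediateField.adjoin K (Set.range fun i => aeval (genVec K m) (P.coord i))
  have hpE : ∀ i, aeval (genVec K m) (P.coord i) ∈ E := fun i =>
    IntermediateField.subset_adjoin K _ ⟨i, rfl⟩
  have hbasis : IsTranscendenceBasis K fun i => aeval (genVec K m) (P.coord (f i)) :=
    (algebraicIndependent_aeval_genVec hP).isTranscendenceBasis_of_lift_trdeg_le_of_finite
      isTranscendenceBasis_genVec.lift_cardinalMk_eq_trdeg.ge
  -- `E` contains the `m + 1` independent values of `P`, which already form a transcendence basis.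
  have halg : Algebra.IsAlgebraic E (GenField K m) := by
    have hle : IntermediateField.adjoin K
        (Set.range fun i => aeval (genVec K m) (P.coord (f i))) ≤ E :=
      IntermediateField.adjoin_le_iff.2 (by rintro _ ⟨i, rfl⟩; exact hpE _)
    have := hbasis.isAlgebraic_field
    let : Algebra (IntermediateField.adjoin K
        (Set.range fun i => aeval (genVec K m) (P.coord (f i)))) E :=
      (IntermediateField.inclusion hle).toRingHom.toAlgebra
    have : IsScalarTower (IntermediateField.adjoin K
        (Set.range fun i => aeval (genVec K m) (P.coord (f i)))) E (GenField K m) :=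
      IsScalarTower.of_algebraMap_eq (congrFun rfl)
    exact Algebra.IsAlgebraic.extendScalars (IntermediateField.inclusion_injective hle)
  have : CharZero E := charZero_of_injective_algebraMap (algebraMap K E).injective
  have : IsAlgClosure E (GenField K m) := ⟨inferInstance, halg⟩
  have : Normal E (GenField K m) := IsAlgClosure.normal E (GenField K m)
  have : IsGalois E (GenField K m) := ⟨⟩
  have hfix : ∀ σ : Gal(GenField K m/E), σ (aeval (genVec K m) (S.coord i) /
      aeval (genVec K m) (S.coord l)) =
      aeval (genVec K m) (S.coord i) / aeval (genVec K m) (S.coord l) := fun σ => by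
    have hσ : ∀ F : MvPolynomial (Fin (m + 1)) K,
        aeval (fun j => σ (genVec K m j)) F = σ (aeval (genVec K m) F) := fun F =>
      (DFunLike.congr_fun (comp_aeval (genVec K m)
        ((σ : GenField K m →ₐ[E] GenField K m).restrictScalars K)) F).symm
    have hne : (fun j => σ (genVec K m j)) ≠ 0 := fun h0 => genVec_ne_zero <| funext fun j =>
      (map_eq_zero σ).1 (congrFun h0 j)
    -- `σ` fixes the values of `P` at `h`, so `P(σ h) = P(h)` and `σ h` lies in the fiber of `P`.
    have hmem := h ((mk_mem_genericFiber_iff P _ hne).2 ⟨1, one_ne_zero, fun j => by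
      rw [hσ, one_mul]
      exact σ.commutes ⟨_, hpE j⟩⟩)
    obtain ⟨c, hc, hcS⟩ := (mk_mem_genericFiber_iff S _ hne).1 hmem
    rw [map_div₀, ← hσ, ← hσ, hcS, hcS, mul_div_mul_left _ _ hc]
  obtain ⟨z, hz⟩ := (InfiniteGalois.mem_range_algebraMap_iff_fixed _).2 hfix
  rw [← hz]
  exact z.2

/-- If the generic fiber of `P` is contained in that of `S`, then every ratio of coordinates of
`S` is a ratio of forms of one degree in the coordinates of `P`. -/
theorem exists_forms_of_genericFiber_subset {P : RatMap K m k} {S : RatMap K m n}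
    (hdeg : 0 < P.deg) {f : Fin (m + 1) → Fin (k + 1)}
    (hP : AlgebraicIndependent K fun i => P.coord (f i))
    (h : genericFiber P ⊆ genericFiber S) {l : Fin (n + 1)} (hl : S.coord l ≠ 0)
    (i : Fin (n + 1)) :
    ∃ (A B : MvPolynomial (Fin (k + 1)) K) (e : ℕ), A.IsHomogeneous e ∧ B.IsHomogeneous e ∧
      aeval P.coord B ≠ 0 ∧
      aeval P.coord B * S.coord i = aeval P.coord A * S.coord l := by
  obtain ⟨A, B, hAB⟩ := (IntermediateField.mem_adjoin_range_iff K _ _).1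
    (div_mem_adjoin_of_genericFiber_subset hP h i l)
  have hcomp : ∀ F, aeval (fun i => aeval (genVec K m) (P.coord i)) F =
      aeval (genVec K m) (aeval P.coord F) := fun F =>
    (DFunLike.congr_fun (comp_aeval P.coord (aeval (genVec K m))) F).symm
  rw [hcomp, hcomp] at hAB
  have hgen := (isTranscendenceBasis_genVec (K := K) (m := m)).1
  have hinj : ∀ F : MvPolynomial (Fin (m + 1)) K, aeval (genVec K m) F = 0 → F = 0 := fun F =>
    hgen.eq_zero_of_aeval_eq_zero F
  have hl0 := aeval_ne_zero hgen hl
  -- If the denominator vanishes, the quotient is `0` by convention, so `S.coord i = 0` and `0/1`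
  -- serves.
  by_cases hB : aeval P.coord B = 0
  · rw [hB, map_zero, div_zero, div_eq_zero_iff, or_iff_left hl0] at hAB
    exact ⟨0, 1, 0, isHomogeneous_zero _ _ _, isHomogeneous_one _ _, by simp,
      by simp [hinj _ hAB]⟩
  · have hB0 := aeval_ne_zero hgen hB
    rw [div_eq_div_iff hl0 hB0, ← map_mul, ← map_mul] at hAB
    have heq : aeval P.coord B * S.coord i = aeval P.coord A * S.coord l := by
      rw [← sub_eq_zero]
      exact hinj _ (by rw [map_sub, sub_eq_zero, mul_comm, hAB])
    obtain ⟨e, -, he⟩ : ∃ e ∈ Finset.range (B.totalDegree + 1),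
        aeval P.coord (homogeneousComponent e B) ≠ 0 := by
      apply Finset.exists_ne_zero_of_sum_ne_zero
      rwa [← map_sum, sum_homogeneousComponent]
    refine ⟨homogeneousComponent e A, homogeneousComponent e B, e,
      homogeneousComponent_isHomogeneous _ _, homogeneousComponent_isHomogeneous _ _, he, ?_⟩
    -- In this degree only the components of degree `e` of `A` and `B` contribute.
    have := congrArg (homogeneousComponent (P.deg * e + S.deg)) heq
    rwa [homogeneousComponent_add_mul _ _ (S.homogeneous i),
      homogeneousComponent_add_mul _ _ (S.homogeneous l),
      homogeneousComponent_aeval hdeg P.homogeneous,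
      homogeneousComponent_aeval hdeg P.homogeneous] at this

/-- If the generic fiber of `P` is contained in that of `S`, then `S` factors rationally
through `P`. -/
theorem exists_isComp_of_genericFiber_subset {P : RatMap K m k} {S : RatMap K m n}
    (hdeg : 0 < P.deg) {f : Fin (m + 1) → Fin (k + 1)}
    (hP : AlgebraicIndependent K fun i => P.coord (f i))
    (h : genericFiber P ⊆ genericFiber S) : ∃ R : RatMap K k n, RatMap.IsComp R P S := by
  classical
  obtain ⟨l, hl⟩ := S.exists_ne_zero
  choose A B e hA hB hB0 hAB using exists_forms_of_genericFiber_subset hdeg hP h hl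
  have hprod : ∀ i, aeval P.coord (A i * ∏ j ∈ Finset.univ.erase i, B j) * S.coord l =
      aeval P.coord (∏ j, B j) * S.coord i := fun i => by
    rw [map_mul, mul_right_comm, ← hAB, ← Finset.mul_prod_erase _ _ (Finset.mem_univ i), map_mul]
    ring
  have hprod0 : aeval P.coord (∏ j, B j) ≠ 0 := by
    rw [map_prod]
    exact Finset.prod_ne_zero_iff.2 fun j _ => hB0 j
  have hRl : aeval P.coord (A l * ∏ j ∈ Finset.univ.erase l, B j) ≠ 0 := fun h0 => by
    have := hprod l
    rw [h0, zero_mul, eq_comm, mul_eq_zero] at this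
    exact this.elim hprod0 hl
  -- The fractions `A i / B i` over the common denominator `∏ B j`, which makes all numerators forms
  -- of degree `∑ e j`.
  let R : RatMap K k n :=
    { coord := fun i => A i * ∏ j ∈ Finset.univ.erase i, B j
      deg := ∑ j, e j
      homogeneous := fun i => by
        rw [← Finset.add_sum_erase _ _ (Finset.mem_univ i)]
        exact (hA i).mul (IsHomogeneous.prod _ _ _ fun j _ => hB j)
      exists_ne_zero := ⟨l, fun h0 => hRl (by rw [h0, map_zero])⟩ }
  have hR : ∀ i, RatMap.compCoord R P i * S.coord l = aeval P.coord (∏ j, B j) * S.coord i := hprod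
  refine ⟨R, ⟨l, hRl⟩, fun i j => mul_right_cancel₀ hl ?_⟩
  linear_combination S.coord j * hR i - S.coord i * hR j

end Galois

/-! ### Equivalence of the two conditions. -/

section Equivalence

variable {K : Type*} [Field K] [IsAlgClosed K] [CharZero K] {V : Set (ℙ K (Fin 4 → K))}
  {P Q : RatMap K 2 3} {S : RatMap K 2 2}

/-- `(Q, S)` solves the reparametrization problem for `P` if and only if `P` and `S` have the same
generic fiber. -/
theorem solvesReparam_iff (hV : IsProjSurface V) (hP : Parametrizes P V)
    (hQS : RatMap.IsComp Q S P) : SolvesReparam V P Q S ↔ genericFiber P = genericFiber S := by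
  have : Infinite K := IsAlgClosed.instInfinite
  have hS := algebraicIndependent_inner hV hP hQS
  have hSdeg := deg_pos_of_algebraicIndependent S (f := fun i => i) hS
  obtain ⟨f, hf⟩ := exists_algebraicIndependent_coord hV hP
  have hPdeg := deg_pos_of_algebraicIndependent P hf
  rw [SolvesReparam, isBirationalParametrization_iff hP hS hQS, and_iff_left hQS]
  constructor
  · rintro ⟨R, hR⟩
    -- The same inclusion is used twice, for `S = R ∘ P` and for `P = Q ∘ S`.
    exact (genericFiber_inner_subset hPdeg hf hR).antisymm
      (genericFiber_inner_subset hSdeg (f := fun i => i) hS hQS)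
  · intro h
    exact exists_isComp_of_genericFiber_subset hPdeg hf h.subset

end Equivalence

/-! ### Values of rational functions; the ideal of an affine image. -/

section Values

variable {K : Type*} [Field K] {m n : ℕ} {L : Type*} [Field L] [Algebra K L]

theorem algebraMap_ratFun_ne_zero {g : MvPolynomial (Fin m) K} (hg : g ≠ 0) :
    algebraMap (MvPolynomial (Fin m) K) (RatFun K m) g ≠ 0 :=
  (map_ne_zero_iff _ (IsFractionRing.injective _ _)).2 hg

theorem ne_zero_of_aeval_ne_zero {g : MvPolynomial (Fin m) K} {a : Fin m → L}
    (h : aeval a g ≠ 0) : g ≠ 0 := fun h0 => h (by rw [h0, map_zero])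

theorem HasValueAt.unique {φ : RatFun K m} {a : Fin m → L} {y y' : L} (h : HasValueAt φ a y)
    (h' : HasValueAt φ a y') : y = y' := by
  obtain ⟨f, g, hg, hφ, rfl⟩ := h
  obtain ⟨f', g', hg', hφ', rfl⟩ := h'
  rw [hφ, div_eq_div_iff (algebraMap_ratFun_ne_zero (ne_zero_of_aeval_ne_zero hg))
    (algebraMap_ratFun_ne_zero (ne_zero_of_aeval_ne_zero hg')), ← map_mul, ← map_mul] at hφ'
  have := congrArg (aeval a) (IsFractionRing.injective (MvPolynomial (Fin m) K) (RatFun K m) hφ')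
  rw [map_mul, map_mul] at this
  rw [div_eq_div_iff hg hg', this]

theorem hasValueAt_algebraMap (F : MvPolynomial (Fin m) K) (a : Fin m → L) :
    HasValueAt (algebraMap _ (RatFun K m) F) a (aeval a F) :=
  ⟨F, 1, by simp, by simp, by simp⟩

theorem HasValueAt.add {φ ψ : RatFun K m} {a : Fin m → L} {y z : L} (h : HasValueAt φ a y)
    (h' : HasValueAt ψ a z) : HasValueAt (φ + ψ) a (y + z) := by
  obtain ⟨f, g, hg, rfl, rfl⟩ := h
  obtain ⟨f', g', hg', rfl, rfl⟩ := h'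
  refine ⟨f * g' + g * f', g * g', by simp [hg, hg'], ?_, ?_⟩
  · rw [div_add_div _ _ (algebraMap_ratFun_ne_zero (ne_zero_of_aeval_ne_zero hg))
      (algebraMap_ratFun_ne_zero (ne_zero_of_aeval_ne_zero hg'))]
    simp only [map_add, map_mul]
  · rw [div_add_div _ _ hg hg']
    simp only [map_add, map_mul]

theorem HasValueAt.mul {φ ψ : RatFun K m} {a : Fin m → L} {y z : L} (h : HasValueAt φ a y)
    (h' : HasValueAt ψ a z) : HasValueAt (φ * ψ) a (y * z) := by
  obtain ⟨f, g, hg, rfl, rfl⟩ := h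
  obtain ⟨f', g', hg', rfl, rfl⟩ := h'
  exact ⟨f * f', g * g', by simp [hg, hg'], by rw [div_mul_div_comm, map_mul, map_mul],
    by rw [div_mul_div_comm, map_mul, map_mul]⟩

theorem HasValueAt.aeval {φ : Fin n → RatFun K m} {a : Fin m → L} {y : Fin n → L}
    (h : ∀ i, HasValueAt (φ i) a (y i)) (H : MvPolynomial (Fin n) K) :
    HasValueAt (MvPolynomial.aeval φ H) a (MvPolynomial.aeval y H) := by
  induction H using MvPolynomial.induction_on with
  | C c =>
    have := hasValueAt_algebraMap (C c : MvPolynomial (Fin m) K) a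
    rw [aeval_C, ← algebraMap_eq, ← IsScalarTower.algebraMap_apply] at this
    rwa [aeval_C, aeval_C]
  | add p q hp hq =>
    rw [map_add, map_add]
    exact hp.add hq
  | mul_X p i hp =>
    rw [map_mul, map_mul, aeval_X, aeval_X]
    exact hp.mul (h i)

/-- A polynomial vanishes on the image of an affine rational map if and only if substituting the
coordinates of the map into it gives zero. -/
theorem mem_vanishingIdeal_affImage_iff [Infinite K] (φ : Fin n → RatFun K m)
    (H : MvPolynomial (Fin n) K) :
    H ∈ vanishingIdeal K (affImage φ) ↔ aeval φ H = 0 := by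
  constructor
  · intro h
    have hfrac : ∀ ψ : RatFun K m, ∃ f g : MvPolynomial (Fin m) K, g ≠ 0 ∧
        ψ = algebraMap _ (RatFun K m) f / algebraMap _ (RatFun K m) g := fun ψ => by
      obtain ⟨f, g, hg, hfg⟩ := IsFractionRing.div_surjective (A := MvPolynomial (Fin m) K) ψ
      exact ⟨f, g, nonZeroDivisors.ne_zero hg, hfg.symm⟩
    choose f g hg hφ using fun i => hfrac (φ i)
    obtain ⟨F, G, hG, hFG⟩ := hfrac (aeval φ H)
    -- Away from the zeros of all denominators, `H(φ)` has the value `0` because `H` vanishes on the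
    -- image, and also the value `F/G`.
    have h0 : F * ((∏ i, g i) * G) = 0 := by
      apply MvPolynomial.funext
      intro v
      by_contra hne
      simp only [map_mul, map_zero, map_prod, mul_eq_zero, not_or, Finset.prod_eq_zero_iff,
        Finset.mem_univ, true_and, not_exists] at hne
      obtain ⟨h1, h2, h3⟩ := hne
      have hval : ∀ i, HasValueAt (φ i) v (aeval v (f i) / aeval v (g i)) := fun i =>
        ⟨f i, g i, h2 i, hφ i, rfl⟩
      have hH := HasValueAt.aeval hval H
      rw [h _ ⟨v, hval⟩] at hH
      have := hH.unique ⟨F, G, h3, hFG, rfl⟩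
      exact (div_ne_zero h1 h3) this.symm
    have hF : F = 0 := (mul_eq_zero.1 h0).resolve_right
      (mul_ne_zero (Finset.prod_ne_zero_iff.2 fun i _ => hg i) hG)
    rw [hFG, hF, map_zero, zero_div]
  · rintro h y ⟨a, ha⟩
    have h1 := HasValueAt.aeval ha H
    rw [h] at h1
    have h2 := hasValueAt_algebraMap (0 : MvPolynomial (Fin m) K) a
    rw [map_zero, map_zero] at h2
    exact h1.unique h2

end Values

/-! ### Passage between forms and affine coordinates. -/

section Dehomogenization

variable {K : Type*} [Field K] {m n k : ℕ}

/-- Dehomogenization: the last variable is set to `1`. -/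
def dehom : MvPolynomial (Fin (m + 1)) K →ₐ[K] MvPolynomial (Fin m) K :=
  aeval (Fin.snoc X 1 : Fin (m + 1) → MvPolynomial (Fin m) K)

theorem aeval_dehom {A : Type*} [CommRing A] [Algebra K A] (a : Fin m → A)
    (F : MvPolynomial (Fin (m + 1)) K) :
    aeval a (dehom F) = aeval (Fin.snoc a 1 : Fin (m + 1) → A) F := by
  rw [dehom, ← AlgHom.comp_apply, comp_aeval]
  congr 2
  funext i
  refine Fin.lastCases ?_ (fun i => ?_) i <;> simp

variable (K m) in
/-- The vector `τ = (t₁/t_{m+1}, …, t_m/t_{m+1})`. -/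
def ratioVec : Fin m → RatFun K (m + 1) := fun i =>
  algebraMap (MvPolynomial (Fin (m + 1)) K) (RatFun K (m + 1)) (X i.castSucc) /
    algebraMap (MvPolynomial (Fin (m + 1)) K) (RatFun K (m + 1)) (X (Fin.last m))

/-- A form is recovered from its dehomogenization. -/
theorem algebraMap_eq_pow_mul_aeval_dehom {F : MvPolynomial (Fin (m + 1)) K} {d : ℕ}
    (hF : F.IsHomogeneous d) : algebraMap _ (RatFun K (m + 1)) F =
      algebraMap (MvPolynomial (Fin (m + 1)) K) (RatFun K (m + 1)) (X (Fin.last m)) ^ d *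
        aeval (ratioVec K m) (dehom F) := by
  have hX := algebraMap_ratFun_ne_zero (X_ne_zero (R := K) (Fin.last m))
  rw [aeval_dehom, ← aeval_mul_of_isHomogeneous hF]
  have : (fun i => algebraMap (MvPolynomial (Fin (m + 1)) K) (RatFun K (m + 1)) (X (Fin.last m)) *
      (Fin.snoc (ratioVec K m) 1 : Fin (m + 1) → RatFun K (m + 1)) i) =
      fun i => IsScalarTower.toAlgHom K (MvPolynomial (Fin (m + 1)) K) (RatFun K (m + 1)) (X i) := by
    funext i
    refine Fin.lastCases ?_ (fun i => ?_) i
    · simp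
    · simp only [Fin.snoc_castSucc, ratioVec]
      exact mul_div_cancel₀ _ hX
  rw [this, ← comp_aeval, AlgHom.comp_apply, aeval_X_left_apply]
  rfl

theorem dehom_ne_zero {F : MvPolynomial (Fin (m + 1)) K} {d : ℕ} (hF : F.IsHomogeneous d)
    (h : F ≠ 0) : dehom F ≠ 0 := fun h0 => algebraMap_ratFun_ne_zero h <| by
  rw [algebraMap_eq_pow_mul_aeval_dehom hF, h0, map_zero, mul_zero]

/-- The ratios of an algebraically independent family by its last member are algebraically
independent. -/
theorem AlgebraicIndependent.div_last {L : Type*} [Field L] [Algebra K L] {x : Fin (n + 1) → L}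
    (hx : AlgebraicIndependent K x) :
    AlgebraicIndependent K fun i : Fin n => x i.castSucc / x (Fin.last n) := by
  have hl : x (Fin.last n) ≠ 0 := hx.ne_zero _
  have h : AlgebraicIndependent K (Fin.snoc (fun i : Fin n => x i.castSucc / x (Fin.last n))
      (x (Fin.last n)) : Fin (n + 1) → L) := by
    refine AlgebraicIndependent.of_eq_aeval hx
      (Fin.snoc (fun i => X i.castSucc * X (Fin.last n)) (X (Fin.last n))) fun i => ?_
    refine Fin.lastCases ?_ (fun i => ?_) i
    · simp
    · simp [hl]
  have := h.comp Fin.castSucc (Fin.castSucc_injective n)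
  simpa [Function.comp_def] using this

theorem algebraicIndependent_ratioVec : AlgebraicIndependent K (ratioVec K m) := by
  have h := (algebraicIndependent_algebraMap (L := RatFun K (m + 1))).2
    (algebraicIndependent_X (Fin (m + 1)) K)
  have h' := AlgebraicIndependent.div_last (L := RatFun K (m + 1)) h
  exact h'

theorem affine_eq (M : RatMap K m n) (i : Fin n) : M.affine i =
    algebraMap _ (RatFun K m) (dehom (M.coord i.castSucc)) /
      algebraMap _ (RatFun K m) (dehom (M.coord (Fin.last n))) := rfl

/-- At `τ` the functions `S.affine` take as values the ratios of the forms `S.coord`, which are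
independent by `AlgebraicIndependent.div_last`; a relation would persist there. -/
theorem algebraicIndependent_affine {S : RatMap K m n} (hS : AlgebraicIndependent K S.coord) :
    AlgebraicIndependent K S.affine := by
  rw [algebraicIndependent_iff]
  intro G hG
  have hl : S.coord (Fin.last n) ≠ 0 := hS.ne_zero _
  have hX := algebraMap_ratFun_ne_zero (X_ne_zero (R := K) (Fin.last m))
  have hval : ∀ i, HasValueAt (S.affine i) (ratioVec K m)
      (algebraMap _ (RatFun K (m + 1)) (S.coord i.castSucc) /
        algebraMap _ (RatFun K (m + 1)) (S.coord (Fin.last n))) := fun i =>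
    ⟨dehom (S.coord i.castSucc), dehom (S.coord (Fin.last n)),
      aeval_ne_zero algebraicIndependent_ratioVec (dehom_ne_zero (S.homogeneous _) hl), rfl, by
      rw [algebraMap_eq_pow_mul_aeval_dehom (S.homogeneous i.castSucc),
        algebraMap_eq_pow_mul_aeval_dehom (S.homogeneous (Fin.last n)),
        mul_div_mul_left _ _ (pow_ne_zero _ hX)]⟩
  have h1 := HasValueAt.aeval hval G
  have h2 := hasValueAt_algebraMap (0 : MvPolynomial (Fin m) K) (ratioVec K m)
  rw [hG] at h1
  rw [map_zero, map_zero] at h2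
  have hS' := (algebraicIndependent_algebraMap (L := RatFun K (m + 1))).2 hS
  exact (AlgebraicIndependent.div_last hS').eq_zero_of_aeval_eq_zero G (h1.unique h2)

/-- The affine form of a composition. -/
theorem affine_mul_aeval_dehom {P : RatMap K m k} {Q : RatMap K n k} {S : RatMap K m n}
    (hs : S.coord (Fin.last n) ≠ 0) (hp : P.coord (Fin.last k) ≠ 0) (hQS : RatMap.IsComp Q S P)
    (j : Fin k) : P.affine j * aeval S.affine (dehom (Q.coord (Fin.last k))) =
      aeval S.affine (dehom (Q.coord j.castSucc)) := by
  have hs0 := algebraMap_ratFun_ne_zero (dehom_ne_zero (S.homogeneous _) hs)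
  have hp0 := algebraMap_ratFun_ne_zero (dehom_ne_zero (P.homogeneous _) hp)
  -- Pulling the last coordinate out of `S` leaves the vector `(S.affine, 1)`, and the form `Q.coord
  -- i` scales by a power.
  have hcomp : ∀ i, algebraMap _ (RatFun K m) (dehom (RatMap.compCoord Q S i)) =
      algebraMap _ (RatFun K m) (dehom (S.coord (Fin.last n))) ^ Q.deg *
        aeval S.affine (dehom (Q.coord i)) := fun i => by
    rw [aeval_dehom, ← aeval_mul_of_isHomogeneous (Q.homogeneous i), dehom, aeval_compCoord]
    have := DFunLike.congr_fun (comp_aeval (fun j => dehom (S.coord j))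
      (IsScalarTower.toAlgHom K (MvPolynomial (Fin m) K) (RatFun K m))) (Q.coord i)
    refine this.trans ?_
    congr 2
    funext j
    refine Fin.lastCases ?_ (fun j => ?_) j
    · simp
      rfl
    · simp only [Fin.snoc_castSucc, affine_eq]
      exact (mul_div_cancel₀ _ hs0).symm
  have h := congrArg (fun F => algebraMap _ (RatFun K m) (dehom F))
    (hQS.2 j.castSucc (Fin.last k))
  simp only [map_mul, hcomp] at h
  apply mul_left_cancel₀ (pow_ne_zero Q.deg hs0)
  rw [affine_eq, div_mul_eq_mul_div, ← mul_div_assoc, div_eq_iff hp0]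
  linear_combination -h

end Dehomogenization

/-! ### Equations linear in `z` and the recovery of `Q`. -/

section ImplicitEquation

variable {K : Type*} [Field K]

/-- Over `K[x, y]` this is a polynomial of degree one in `z` with coprime coefficients. -/
theorem irreducible_linearInZ {A₁ A₀ : MvPolynomial (Fin 2) K} (h0 : A₀ ≠ 0)
    (h : IsRelPrime A₁ A₀) : Irreducible (linearInZ A₁ A₀) := by
  let e : MvPolynomial (Fin 3) K ≃ₐ[K] Polynomial (MvPolynomial (Fin 2) K) :=
    (renameEquiv K (finSuccEquivLast (n := 2))).trans (optionEquivLeft K (Fin 2))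
  have hC : ∀ A, e (rename Fin.castSucc A) = Polynomial.C A := fun A => by
    have : (e : _ →ₐ[K] _).comp (rename Fin.castSucc) =
        (Polynomial.CAlgHom : MvPolynomial (Fin 2) K →ₐ[K] _) := by
      ext i
      simp [e]
    exact DFunLike.congr_fun this A
  have hX : e (X (Fin.last 2)) = Polynomial.X := by
    rw [AlgEquiv.trans_apply, renameEquiv_apply, rename_X, finSuccEquivLast_last,
      optionEquivLeft_X_none]
  refine Irreducible.of_map (f := e) ?_
  have := Polynomial.irreducible_C_mul_X_add_C (neg_ne_zero.2 h0) h.symm.neg_left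
  rw [linearInZ, map_sub, map_mul, hC, hC, hX]
  convert this using 1
  rw [Polynomial.C_neg]
  ring

theorem aeval_linearInZ {L : Type*} [CommRing L] [Algebra K L] (A₁ A₀ : MvPolynomial (Fin 2) K)
    (φ : Fin 3 → L) : aeval φ (linearInZ A₁ A₀) =
      aeval (φ ∘ Fin.castSucc) A₁ - aeval (φ ∘ Fin.castSucc) A₀ * φ (Fin.last 2) := by
  rw [linearInZ, map_sub, map_mul, aeval_rename, aeval_rename, aeval_X]

/-- Modulo `A₁ - A₀ z`, a power of `A₀` times any polynomial is free of `z`. -/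
theorem exists_pow_mul_sub_rename (A₁ A₀ : MvPolynomial (Fin 2) K) (H : MvPolynomial (Fin 3) K) :
    ∃ (N : ℕ) (r : MvPolynomial (Fin 2) K),
      linearInZ A₁ A₀ ∣ rename Fin.castSucc A₀ ^ N * H - rename Fin.castSucc r := by
  induction H using MvPolynomial.induction_on with
  | C c => exact ⟨0, C c, by simp⟩
  | add p q hp hq =>
    obtain ⟨N, r, g, h⟩ := hp
    obtain ⟨N', r', g', h'⟩ := hq
    refine ⟨N + N', A₀ ^ N' * r + A₀ ^ N * r',
      rename Fin.castSucc A₀ ^ N' * g + rename Fin.castSucc A₀ ^ N * g', ?_⟩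
    simp only [map_add, map_mul, map_pow]
    linear_combination rename Fin.castSucc A₀ ^ N' * h + rename Fin.castSucc A₀ ^ N * h'
  | mul_X p i hp =>
    obtain ⟨N, r, g, h⟩ := hp
    refine Fin.lastCases ?_ (fun i => ?_) i
    · refine ⟨N + 1, r * A₁,
        rename Fin.castSucc A₀ * X (Fin.last 2) * g - rename Fin.castSucc r, ?_⟩
      rw [map_mul]
      have hl : linearInZ A₁ A₀ =
        rename Fin.castSucc A₁ - rename Fin.castSucc A₀ * X (Fin.last 2) := rfl
      linear_combination rename Fin.castSucc A₀ * X (Fin.last 2) * h + rename Fin.castSucc r * hl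
    · refine ⟨N, r * X i, X i.castSucc * g, ?_⟩
      rw [map_mul, rename_X]
      linear_combination X i.castSucc * h

/-- Multiplying `H` by a power of `A₀` reduces it to a polynomial `r` without `z`. If `H` vanishes
at `φ`, so does `r`, and independence gives `r = 0`. The prime `A₁ - A₀ z` then divides `A₀ ^ N * H`
but not `A₀`. -/
theorem linearInZ_dvd_iff {L : Type*} [Field L] [Algebra K L] {A₁ A₀ : MvPolynomial (Fin 2) K}
    (h0 : A₀ ≠ 0) (hirr : Irreducible (linearInZ A₁ A₀)) {φ : Fin 3 → L}
    (hφ : AlgebraicIndependent K (φ ∘ Fin.castSucc)) (hl : aeval φ (linearInZ A₁ A₀) = 0)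
    (H : MvPolynomial (Fin 3) K) : linearInZ A₁ A₀ ∣ H ↔ aeval φ H = 0 := by
  have hmem : ∀ {F}, linearInZ A₁ A₀ ∣ F → aeval φ F = 0 := by
    rintro _ ⟨G, rfl⟩
    rw [map_mul, hl, zero_mul]
  refine ⟨hmem, fun h => ?_⟩
  obtain ⟨N, r, hr⟩ := exists_pow_mul_sub_rename A₁ A₀ H
  have h1 := hmem hr
  rw [map_sub, map_mul, h, mul_zero, zero_sub, neg_eq_zero, aeval_rename] at h1
  rw [hφ.eq_zero_of_aeval_eq_zero r h1, map_zero, sub_zero] at hr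
  refine (hirr.prime.dvd_or_dvd hr).resolve_left fun hd => ?_
  have h2 := hmem (hirr.prime.dvd_of_dvd_pow hd)
  rw [aeval_rename] at h2
  exact h0 (hφ.eq_zero_of_aeval_eq_zero A₀ h2)

theorem Phi_comp_castSucc (P : RatMap K 2 3) (S : RatMap K 2 2) (j : Fin 3) :
    Phi P S j ∘ Fin.castSucc = S.affine := by
  funext i
  fin_cases i <;> rfl

theorem aeval_Phi_linearInZ (P : RatMap K 2 3) (S : RatMap K 2 2) (j : Fin 3)
    (A₁ A₀ : MvPolynomial (Fin 2) K) : aeval (Phi P S j) (linearInZ A₁ A₀) =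
      aeval S.affine A₁ - aeval S.affine A₀ * P.affine j := by
  rw [aeval_linearInZ, Phi_comp_castSucc]
  rfl

variable {P Q : RatMap K 2 3} {S : RatMap K 2 2}

theorem outer_last_ne_zero (hp : P.coord 3 ≠ 0) (hQS : RatMap.IsComp Q S P) : Q.coord 3 ≠ 0 :=
  fun h => compCoord_ne_zero hQS hp (by rw [RatMap.compCoord, h, map_zero])

/-- `Φ_j` parametrizes a surface with an irreducible equation linear in `z`. -/
theorem exists_isImplicitEq [Infinite K] (hS : AlgebraicIndependent K S.coord)
    (hp : P.coord 3 ≠ 0) (hQS : RatMap.IsComp Q S P) (j : Fin 3) :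
    ∃ A₁ A₀ : MvPolynomial (Fin 2) K, IsImplicitEq (Phi P S j) A₁ A₀ := by
  have hq : dehom (Q.coord 3) ≠ 0 := dehom_ne_zero (Q.homogeneous 3) (outer_last_ne_zero hp hQS)
  have haff := algebraicIndependent_affine hS
  -- `A₁ / A₀` is the dehomogenized `q_j / q₄` in lowest terms, with `c` the common factor.
  obtain ⟨A₁, A₀, c, hrel, h1, h2⟩ := UniqueFactorizationMonoid.exists_reduced_factors'
    (dehom (Q.coord j.castSucc)) (dehom (Q.coord 3)) hq
  have hA0 : A₀ ≠ 0 := fun h => hq (by rw [← h2, h, mul_zero])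
  have hc : c ≠ 0 := fun h => hq (by rw [← h2, h, zero_mul])
  have hirr := irreducible_linearInZ hA0 hrel
  have hl : aeval (Phi P S j) (linearInZ A₁ A₀) = 0 := by
    have := affine_mul_aeval_dehom (hS.ne_zero _) hp hQS j
    rw [← h1, show Q.coord (Fin.last 3) = Q.coord 3 from rfl, ← h2, map_mul, map_mul] at this
    rw [aeval_Phi_linearInZ]
    apply mul_left_cancel₀ (aeval_ne_zero haff hc)
    linear_combination -this
  refine ⟨A₁, A₀, hA0, hirr, ?_⟩
  rw [ParametrizesAffine]
  congr 1
  ext H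
  rw [mem_vanishingIdeal_affImage_iff, Ideal.mem_span_singleton,
    linearInZ_dvd_iff hA0 hirr (by rwa [Phi_comp_castSucc]) hl]

theorem aeval_eq_zero_of_isImplicitEq [Infinite K] {φ : Fin 3 → RatFun K 2}
    {A₁ A₀ : MvPolynomial (Fin 2) K} (h : IsImplicitEq φ A₁ A₀) :
    aeval φ (linearInZ A₁ A₀) = 0 := by
  rw [← mem_vanishingIdeal_affImage_iff]
  intro y hy
  have := zeroLocus_vanishingIdeal_le (k := K) (affImage φ) hy
  rw [h.2.2] at this
  exact this _ (Ideal.mem_span_singleton_self _)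

/-- The implicit equations of the `Φ_j` determine `Q`. -/
theorem isHomogenization_of_isImplicitEq [Infinite K] (hS : AlgebraicIndependent K S.coord)
    (hp : P.coord 3 ≠ 0) (hQS : RatMap.IsComp Q S P) {A₁ A₀ : Fin 3 → MvPolynomial (Fin 2) K}
    (h : ∀ j, IsImplicitEq (Phi P S j) (A₁ j) (A₀ j)) :
    IsHomogenization Q (fun j => algebraMap (MvPolynomial (Fin 2) K) (RatFun K 2) (A₁ j) /
      algebraMap (MvPolynomial (Fin 2) K) (RatFun K 2) (A₀ j)) := by
  have haff := algebraicIndependent_affine hS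
  have hq := outer_last_ne_zero hp hQS
  have hτ : ∀ j, aeval (ratioVec K 2) (A₀ j) ≠ 0 := fun j =>
    aeval_ne_zero algebraicIndependent_ratioVec (h j).1
  -- Both fractions express `P.affine j` at the independent point `S.affine`, so they agree
  -- identically.
  have hpoly : ∀ j, dehom (Q.coord j.castSucc) * A₀ j = dehom (Q.coord 3) * A₁ j := fun j => by
    have h1 := aeval_eq_zero_of_isImplicitEq (h j)
    have h2 := affine_mul_aeval_dehom (hS.ne_zero _) hp hQS j
    rw [show Q.coord (Fin.last 3) = Q.coord 3 from rfl] at h2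
    rw [aeval_Phi_linearInZ] at h1
    rw [← sub_eq_zero]
    apply haff.eq_zero_of_aeval_eq_zero
    rw [map_sub, map_mul, map_mul]
    linear_combination -aeval S.affine (dehom (Q.coord 3)) * h1 - aeval S.affine (A₀ j) * h2
  refine ⟨fun j => aeval (ratioVec K 2) (A₁ j) / aeval (ratioVec K 2) (A₀ j),
    fun j => ⟨A₁ j, A₀ j, hτ j, rfl, rfl⟩, ?_⟩
  have hgen : ∀ F : MvPolynomial (Fin 3) K, aeval (fun i => algebraMap (RatFun K 3) (RatFun K 3)
      (algebraMap (MvPolynomial (Fin 3) K) (RatFun K 3) (X i))) F =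
      algebraMap (MvPolynomial (Fin 3) K) (RatFun K 3) F := fun F => by
    have := DFunLike.congr_fun (comp_aeval X
      (IsScalarTower.toAlgHom K (MvPolynomial (Fin 3) K) (RatFun K 3))) F
    rw [AlgHom.comp_apply, aeval_X_left_apply] at this
    exact this.symm
  rw [genPoint, mem_toPFun_mk_iff]
  have hq0 := algebraMap_ratFun_ne_zero hq
  have hne : (fun i => aeval (fun i => algebraMap (RatFun K 3) (RatFun K 3)
      (algebraMap (MvPolynomial (Fin 3) K) (RatFun K 3) (X i))) (Q.coord i)) ≠ 0 := fun h0 =>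
    hq0 ((hgen _).symm.trans (congrFun h0 3))
  refine ⟨hne, (mk_eq_mk_iff_exists hne _).2
    ⟨algebraMap (MvPolynomial (Fin 3) K) (RatFun K 3) (Q.coord 3), hq0, fun i => ?_⟩⟩
  rw [hgen]
  refine Fin.lastCases ?_ (fun j => ?_) i
  · rw [Fin.snoc_last, mul_one]
    rfl
  · have h3 := congrArg (aeval (ratioVec K 2)) (hpoly j)
    rw [map_mul, map_mul] at h3
    rw [Fin.snoc_castSucc, algebraMap_eq_pow_mul_aeval_dehom (Q.homogeneous j.castSucc),
      algebraMap_eq_pow_mul_aeval_dehom (Q.homogeneous 3), mul_assoc, ← mul_div_assoc, ← h3,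
      mul_div_cancel_right₀ _ (hτ j)]

end ImplicitEquation

end BirRep

end

theorem mainTheorem1 {K : Type*} [Field K] [IsAlgClosed K] [CharZero K]
    (V : Set (ℙ K (Fin 4 → K))) (hV : BirRep.IsProjSurface V)
    (P : BirRep.RatMap K 2 3) (hP : BirRep.Parametrizes P V) (hp₄ : P.coord 3 ≠ 0)
    (Q : BirRep.RatMap K 2 3) (S : BirRep.RatMap K 2 2) (hs₃ : S.coord 2 ≠ 0)
    (hQS : BirRep.RatMap.IsComp Q S P) :
    (BirRep.SolvesReparam V P Q S ↔ BirRep.genericFiber P = BirRep.genericFiber S) ∧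
    ((BirRep.SolvesReparam V P Q S ∨ BirRep.genericFiber P = BirRep.genericFiber S) →
      (∀ j : Fin 3, ∃ A₁ A₀ : MvPolynomial (Fin 2) K,
        BirRep.IsImplicitEq (BirRep.Phi P S j) A₁ A₀) ∧
      ∀ A₁ A₀ : Fin 3 → MvPolynomial (Fin 2) K,
        (∀ j, BirRep.IsImplicitEq (BirRep.Phi P S j) (A₁ j) (A₀ j)) →
        BirRep.IsHomogenization Q (fun j =>
          algebraMap (MvPolynomial (Fin 2) K) (BirRep.RatFun K 2) (A₁ j) /
            algebraMap (MvPolynomial (Fin 2) K) (BirRep.RatFun K 2) (A₀ j))) := by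
  have : Infinite K := IsAlgClosed.instInfinite
  have hS := BirRep.algebraicIndependent_inner hV hP hQS
  exact ⟨BirRep.solvesReparam_iff hV hP hQS, fun _ =>
    ⟨BirRep.exists_isImplicitEq hS hp₄ hQS, fun _ _ h =>
      BirRep.isHomogenization_of_isImplicitEq hS hp₄ hQS h⟩⟩
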